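/- Let $n,d\ge 0$ be integers and let $A=\sum_{i=1}^d A_i x_i$, $A_i\in M_n(\mathbb C)$, be an $n\times n$ matrix pencil, with associated completely positive map $\eta_A(B)=\sum_{i=1}^d A_iBA_i^*$ on $M_n(\mathbb C)$. Definitions. $A$ is *full* if there are no subspaces $\mathcal R,\mathcal L\subseteq\mathbb C^n$ with $A_i(\mathcal R)\subseteq\mathcal L$ for all $i$ and $\dim\mathcal R>\dim\mathcal L$. $A$ is *splittable* if there are subspaces $\mathcal R,\mathcal L\subseteq\mathbb C^n$ with $1\le\dim\mathcal R=\dim\mathcal L\le n-1$ and $A_i(\mathcal R)\subseteq\mathcal L$ for all $i$, and *unsplittable* if it is nonzero (some $A_i\ne0$) and not splittable. $A$ is *LR-semisimple* if there are $L,R\in GL_n(\mathbb C)$ and $n_1+\dots+n_k=n$ with $LA_iR=\operatorname{diag}(B^{(1)}_i,\dots,B^{(k)}_i)$, $B^{(j)}_i\in M_{n_j}(\mathbb C)$, for all $i$, where each pencil $B^{(j)}=\sum_i B^{(j)}_ix_i$ is unsplittable. A completely positive map $\eta$ on $M_n(\mathbb C)$ is *rank non-decreasing* if $\operatorname{rank}\eta(B)\ge\operatorname{rank}B$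 for all $B\succeq0$; it is *indecomposable* if $\eta\neq 0$ and $\operatorname{rank}\eta(B)>\operatorname{rank}B$ for all $B\succeq0$ with $1\le\operatorname{rank}B<n$ (the condition $\eta\ne0$ is automatic for $n\ge2$). Its *capacity* is $\operatorname{Cap}(\eta)=\inf\{\det\eta(B): B\succ0,\ \det B=1\}$, and for $c_1,c_2\in M_n(\mathbb C)$ its *scaling* is $S_{c_1,c_2}(\eta)(X)=c_1\,\eta(c_2^*Xc_2)\,c_1^*$. Let $P_1,\dots,P_k\in M_n(\mathbb C)$ be pairwise orthogonal self-adjoint projections with $\sum_jP_j=I$ and $\mathcal D=\operatorname{span}\{P_1,\dots,P_k\}$ (a *diagonal subalgebra*). The map $\eta$ is *$\mathcal D$-corner-indecomposable* if $\eta(D_1XD_2)=D_1\eta(X)D_2$ for all $D_1,D_2\in\mathcal D$ and $X\in M_n(\mathbb C)$, and for every $j$ the map $X\mapsto P_j\eta(X)P_j$ on $P_jM_n(\mathbb C)P_j\cong M_{\operatorname{rank}P_j}(\mathbb C)$ is indecomposable. **Theorem (Pencil–Map Dictionary).** (i) $A$ is full $\iff$ $\eta_A$ is rank non-decreasing $\iff$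 $\operatorname{Cap}(\eta_A)>0$. (ii) $A$ is unsplittable $\iff$ $\eta_A$ is indecomposable. (iii) $A$ is LR-semisimple $\iff$ there exist $c_1,c_2\in GL_n(\mathbb C)$ and a diagonal subalgebra $\mathcal D=\operatorname{span}\{P_1,\dots,P_k\}$ such that $S_{c_1,c_2}(\eta_A)$ is $\mathcal D$-corner-indecomposable. -/

import Mathlib

open Matrix
open scoped ComplexOrder

/-- A linear matrix pencil `A = ∑ i, A i * x i` of size `n` in `d` variables, given by its
coefficient matrices. -/
abbrev MatrixPencil (d n : ℕ) : Type := Fin d → Matrix (Fin n) (Fin n) ℂ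

/-- Linear maps on the algebra of complex `n × n` matrices. The predicates below are only meant for
(and only applied to) completely positive ones. -/
abbrev MatrixMap (n : ℕ) : Type :=
  Matrix (Fin n) (Fin n) ℂ →ₗ[ℂ] Matrix (Fin n) (Fin n) ℂ

namespace MatrixPencil

variable {d n : ℕ}

/-- `A i (R) ⊆ L` for all `i`. -/
def MapsInto (A : MatrixPencil d n) (R L : Submodule ℂ (Fin n → ℂ)) : Prop :=
  ∀ i, R.map (Matrix.toLin' (A i)) ≤ L

/-- A pencil is full if there are no subspaces `R`, `L` with `A i (R) ⊆ L` for all `i` and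
`dim R > dim L`. -/
def IsFull (A : MatrixPencil d n) : Prop :=
  ¬ ∃ R L : Submodule ℂ (Fin n → ℂ),
    A.MapsInto R L ∧ Module.finrank ℂ L < Module.finrank ℂ R

/-- A pencil of size `n` is splittable if there are subspaces `R`, `L` of the same dimension
`s`, `1 ≤ s ≤ n - 1`, with `A i (R) ⊆ L` for all `i`. -/
def IsSplittable (A : MatrixPencil d n) : Prop :=
  ∃ R L : Submodule ℂ (Fin n → ℂ),
    Module.finrank ℂ R = Module.finrank ℂ L ∧
    1 ≤ Module.finrank ℂ R ∧ Module.finrank ℂ R < n ∧ A.MapsInto R L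

/-- A pencil is unsplittable if it is nonzero and not splittable. -/
def IsUnsplittable (A : MatrixPencil d n) : Prop :=
  (∃ i, A i ≠ 0) ∧ ¬ A.IsSplittable

/-- A pencil is LR-semisimple if for some invertible `L`, `R` the matrices `L * A i * R` are
simultaneously block diagonal, `L * A i * R = diag (B 0 i, …, B (k - 1) i)`, with blocks of sizes
`m 0 + ⋯ + m (k - 1) = n` (placed in this order along the diagonal), such that each sub-pencil
`B j` is unsplittable. -/
def IsLRSemisimple (A : MatrixPencil d n) : Prop :=
  ∃ (L R : GL (Fin n) ℂ) (k : ℕ) (m : Fin k → ℕ) (hm : ∑ j, m j = n)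
    (B : ∀ j, MatrixPencil d (m j)),
    (∀ i, (L : Matrix (Fin n) (Fin n) ℂ) * A i * (R : Matrix (Fin n) (Fin n) ℂ) =
      Matrix.reindex (finSigmaFinEquiv.trans (finCongr hm)) (finSigmaFinEquiv.trans (finCongr hm))
        (Matrix.blockDiagonal' fun j => B j i)) ∧
    ∀ j, (B j).IsUnsplittable

/-- The completely positive map `η_A (X) = ∑ i, A i * X * (A i)ᴴ`. -/
def eta (A : MatrixPencil d n) : MatrixMap n where
  toFun X := ∑ i, A i * X * (A i)ᴴ
  map_add' X Y := by simp [Matrix.mul_add, Matrix.add_mul, Finset.sum_add_distrib]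
  map_smul' c X := by simp [Finset.smul_sum]

end MatrixPencil

namespace MatrixMap

variable {n : ℕ}

/-- Rank non-decreasing maps. -/
def IsRankNonDecreasing (η : MatrixMap n) : Prop :=
  ∀ B : Matrix (Fin n) (Fin n) ℂ, B.PosSemidef → B.rank ≤ (η B).rank

/-- The capacity `inf {det (η B) | B ≻ 0, det B = 1}`. For a positive map the determinants are
nonnegative real numbers. -/
noncomputable def capacity (η : MatrixMap n) : ℝ :=
  sInf {t : ℝ | ∃ B : Matrix (Fin n) (Fin n) ℂ, B.PosDef ∧ B.det = 1 ∧ (η B).det = (t : ℂ)}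

/-- Indecomposable maps: `η ≠ 0` and `rank (η B) > rank B` for all `B ⪰ 0` with
`1 ≤ rank B < n`. For `n ≥ 2` the second condition implies the first one. -/
def IsIndecomposable (η : MatrixMap n) : Prop :=
  η ≠ 0 ∧ ∀ B : Matrix (Fin n) (Fin n) ℂ, B.PosSemidef → 1 ≤ B.rank → B.rank < n →
    B.rank < (η B).rank

/-- The operator scaling `S_{c₁,c₂}(η)(X) = c₁ η(c₂ᴴ X c₂) c₁ᴴ`. -/
def scaling (c₁ c₂ : Matrix (Fin n) (Fin n) ℂ) (η : MatrixMap n) : MatrixMap n where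
  toFun X := c₁ * η (c₂ᴴ * X * c₂) * c₁ᴴ
  map_add' X Y := by simp [Matrix.mul_add, Matrix.add_mul]
  map_smul' c X := by simp

/-- `P j` are pairwise orthogonal (self-adjoint) projections with sum `1`. -/
def IsProjectionFamily {k : ℕ} (P : Fin k → Matrix (Fin n) (Fin n) ℂ) : Prop :=
  (∀ j, IsStarProjection (P j)) ∧ (Pairwise fun i j => P i * P j = 0) ∧ ∑ j, P j = 1

/-- `𝒟`-bimodularity for `𝒟 = span {P j}`. -/
def IsBimodular {k : ℕ} (P : Fin k → Matrix (Fin n) (Fin n) ℂ) (η : MatrixMap n) : Prop :=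
  ∀ D₁ ∈ Submodule.span ℂ (Set.range P), ∀ D₂ ∈ Submodule.span ℂ (Set.range P),
    ∀ X, η (D₁ * X * D₂) = D₁ * η X * D₂

/-- For a projection `P`, the corner map `X ↦ P * η X * P` on the corner algebra
`{X | P * X * P = X}`, which is a full matrix algebra of size `rank P`, is indecomposable (with the
identification, positivity and rank are the same in the corner and in the `n × n` matrices). -/
def IsCornerIndecomposable (P : Matrix (Fin n) (Fin n) ℂ) (η : MatrixMap n) : Prop :=
  (∃ X, P * X * P = X ∧ P * η X * P ≠ 0) ∧
  ∀ B : Matrix (Fin n) (Fin n) ℂ, P * B * P = B → B.PosSemidef → 1 ≤ B.rank → B.rank < P.rank →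
    B.rank < (P * η B * P).rank

/-- `η` is `𝒟`-corner-indecomposable for `𝒟 = span {P j}`: the `P j` are pairwise orthogonal
projections with sum `1`, `η` is `𝒟`-bimodular, and all corner maps are indecomposable. -/
def IsDCI {k : ℕ} (P : Fin k → Matrix (Fin n) (Fin n) ℂ) (η : MatrixMap n) : Prop :=
  IsProjectionFamily P ∧ IsBimodular P η ∧ ∀ j, IsCornerIndecomposable (P j) η

end MatrixMap

/-!
The dictionary rests on one fact, `MatrixPencil.range_eta`: for `B ⪰ 0` the range of `η_A(B)` is
`∑ i, A i (range B)`, because `∑ i, M i * (M i)ᴴ` has the same range as the row `(M 0 | M 1 | ⋯)`.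
Every subspace is the range of a positive semidefinite matrix, so statements about ranks of
`η_A(B)` are statements about dimensions of images of subspaces. This is the equivalence of fullness
with rank non-decrease. In `isCornerIndecomposable_eta_iff` the same argument is carried out relative
to a projection `P` whose range is identified with `ℂ^m`: the corner of `η_A` at `P` is
indecomposable iff the pencil that `A` induces on `ℂ^m` is unsplittable. The case `P = 1` compares
unsplittable pencils with indecomposable maps.

Capacity. If `A` is not full, witnessed by subspaces of dimensions `r > l`, then scaling by
one-parameter families adapted to these subspaces drives the determinant to zero
(`exists_det_eta_lt`). If `η_A` is rank non-decreasing, the `j`-th eigenvalue of `η_A(B)` is at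
least a constant times the `j`-th eigenvalue of `B` (decreasing order), by minimax and compactness
of the unitary group, so that the determinant of `η_A(B)` is at least a constant times that of `B`
(`exists_pos_le_det_eta`).

Semisimplicity. Scaling `η_A` replaces `A i` by `c₁ * A i * c₂ᴴ`, and `η_A` is bimodular over
`span {P j}` exactly when `A` commutes with every `P j` (`isBimodular_eta_iff`). Hence, after bases
of the ranges of the `P j` are chosen, a bimodular scaling is a block diagonalization of the pencil,
and the corner criterion is applied to each block.
-/

/-! ### Ranges of matrices and of sums of squares -/

namespace Matrix

theorem finrank_range_toLin' {m n : ℕ} (M : Matrix (Fin m) (Fin n) ℂ) :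
    Module.finrank ℂ (LinearMap.range (toLin' M)) = M.rank := rfl

/-- The row of blocks `(M 0 | M 1 | ⋯)`, so that `∑ i, M i * (M i)ᴴ` is a single product. -/
def blockRow {d n m : ℕ} (M : Fin d → Matrix (Fin n) (Fin m) ℂ) :
    Matrix (Fin n) (Fin d × Fin m) ℂ :=
  Matrix.of fun a p => M p.1 a p.2

theorem blockRow_mul_conjTranspose {d n m : ℕ} (M : Fin d → Matrix (Fin n) (Fin m) ℂ) :
    blockRow M * (blockRow M)ᴴ = ∑ i, M i * (M i)ᴴ := by
  ext a b
  simp [blockRow, Matrix.mul_apply, Matrix.sum_apply, Fintype.sum_prod_type]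

theorem eq_zero_of_sum_mul_conjTranspose_eq_zero {d n m : ℕ}
    {M : Fin d → Matrix (Fin n) (Fin m) ℂ} (h : ∑ i, M i * (M i)ᴴ = 0) (i : Fin d) :
    M i = 0 := by
  rw [← blockRow_mul_conjTranspose, self_mul_conjTranspose_eq_zero] at h
  ext a b
  exact congrFun (congrFun h a) (i, b)

theorem range_mul_conjTranspose_self {m n : Type*} [Fintype m] [Fintype n] [DecidableEq m]
    [DecidableEq n] (M : Matrix m n ℂ) :
    LinearMap.range (toLin' (M * Mᴴ)) = LinearMap.range (toLin' M) := by
  refine Submodule.eq_of_le_of_finrank_eq ?_ (rank_self_mul_conjTranspose M)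
  rw [toLin'_mul]
  exact LinearMap.range_comp_le_range _ _

theorem range_blockRow {d n m : ℕ} (M : Fin d → Matrix (Fin n) (Fin m) ℂ) :
    LinearMap.range (toLin' (blockRow M)) = ⨆ i, LinearMap.range (toLin' (M i)) := by
  apply le_antisymm
  · rintro _ ⟨x, rfl⟩
    have : toLin' (blockRow M) x = ∑ i, toLin' (M i) (fun b => x (i, b)) := by
      ext a
      simp [blockRow, mulVec, dotProduct, Fintype.sum_prod_type]
    rw [this]
    exact Submodule.sum_mem _ fun i _ =>
      Submodule.mem_iSup_of_mem i (LinearMap.mem_range_self _ _)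
  · refine iSup_le fun i => ?_
    rintro _ ⟨x, rfl⟩
    refine ⟨fun p => if p.1 = i then x p.2 else 0, ?_⟩
    ext a
    simp [blockRow, mulVec, dotProduct, Fintype.sum_prod_type]

theorem PosSemidef.exists_eq_mul_conjTranspose {n : ℕ} {B : Matrix (Fin n) (Fin n) ℂ}
    (hB : B.PosSemidef) : ∃ C : Matrix (Fin n) (Fin n) ℂ, B = C * Cᴴ := by
  open scoped MatrixOrder in
  obtain ⟨C, hC⟩ := CStarAlgebra.nonneg_iff_eq_mul_star_self.1 hB.nonneg
  exact ⟨C, hC⟩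

theorem mul_eq_right_of_range_le {n m : ℕ} {P : Matrix (Fin n) (Fin n) ℂ}
    (hP : IsIdempotentElem P) {X : Matrix (Fin n) (Fin m) ℂ}
    (h : LinearMap.range (toLin' X) ≤ LinearMap.range (toLin' P)) : P * X = X := by
  apply toLin'.injective
  refine LinearMap.ext fun x => ?_
  obtain ⟨y, hy⟩ := h (LinearMap.mem_range_self (toLin' X) x)
  rw [toLin'_mul, LinearMap.comp_apply, ← hy, ← LinearMap.comp_apply, ← toLin'_mul, hP.eq]

/-- A subspace of dimension `r` is the range of an injective `n × r` matrix. -/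
theorem exists_mul_eq_one_range_eq {n r : ℕ} (R : Submodule ℂ (Fin n → ℂ))
    (h : Module.finrank ℂ R = r) :
    ∃ (V : Matrix (Fin n) (Fin r) ℂ) (W : Matrix (Fin r) (Fin n) ℂ),
      W * V = 1 ∧ LinearMap.range (toLin' V) = R := by
  let e : (Fin r → ℂ) ≃ₗ[ℂ] R := LinearEquiv.ofFinrankEq _ _ (by simp [h])
  obtain ⟨g, hg⟩ := (R.subtype ∘ₗ e.toLinearMap).exists_leftInverse_of_injective (by
    rw [LinearMap.ker_eq_bot]; exact R.subtype_injective.comp e.injective)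
  refine ⟨LinearMap.toMatrix' (R.subtype ∘ₗ e.toLinearMap), LinearMap.toMatrix' g, ?_, ?_⟩
  · rw [← LinearMap.toMatrix'_comp, hg, LinearMap.toMatrix'_id]
  · simp [LinearMap.range_comp]

theorem rank_of_mul_eq_one {n r : ℕ} {V : Matrix (Fin n) (Fin r) ℂ}
    {W : Matrix (Fin r) (Fin n) ℂ} (h : W * V = 1) : (V * W).rank = r := by
  apply le_antisymm
  · exact (rank_mul_le_left V W).trans (rank_le_width V)
  · have h1 : W * (V * W) * V = 1 := by
      rw [← Matrix.mul_assoc, h, Matrix.one_mul, h]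
    have h2 := (rank_mul_le_left (W * (V * W)) V).trans (rank_mul_le_right W (V * W))
    simpa [h1] using h2

/-- Full-rank factorization of an idempotent matrix. -/
theorem exists_factorization_of_isIdempotentElem {n r : ℕ} {P : Matrix (Fin n) (Fin n) ℂ}
    (hP : IsIdempotentElem P) (hr : P.rank = r) :
    ∃ (V : Matrix (Fin n) (Fin r) ℂ) (W : Matrix (Fin r) (Fin n) ℂ),
      W * V = 1 ∧ V * W = P := by
  obtain ⟨V, W, hWV, hV⟩ := exists_mul_eq_one_range_eq (LinearMap.range (toLin' P)) hr
  have hVW : IsIdempotentElem (V * W) := by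
    rw [IsIdempotentElem, Matrix.mul_assoc, ← Matrix.mul_assoc W, hWV, Matrix.one_mul]
  refine ⟨V, W * P, ?_, ?_⟩
  · rw [Matrix.mul_assoc, mul_eq_right_of_range_le hP hV.le, hWV]
  · rw [← Matrix.mul_assoc]
    refine mul_eq_right_of_range_le hVW ?_
    rw [← hV]
    rintro _ ⟨x, rfl⟩
    refine ⟨toLin' V x, ?_⟩
    rw [← LinearMap.comp_apply, ← toLin'_mul, Matrix.mul_assoc, hWV, Matrix.mul_one]

theorem exists_posSemidef_range_eq {n : ℕ} (R : Submodule ℂ (Fin n → ℂ)) :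
    ∃ B : Matrix (Fin n) (Fin n) ℂ, B.PosSemidef ∧ LinearMap.range (toLin' B) = R := by
  obtain ⟨V, -, -, hV⟩ := exists_mul_eq_one_range_eq R rfl
  exact ⟨V * Vᴴ, posSemidef_self_mul_conjTranspose V, by rw [range_mul_conjTranspose_self, hV]⟩

end Matrix

theorem Submodule.exists_ge_finrank_eq {n p : ℕ} (L : Submodule ℂ (Fin n → ℂ))
    (h : Module.finrank ℂ L ≤ p) (hp : p ≤ n) :
    ∃ L' : Submodule ℂ (Fin n → ℂ), L ≤ L' ∧ Module.finrank ℂ L' = p := by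
  induction p, h using Nat.le_induction with
  | base => exact ⟨L, le_rfl, rfl⟩
  | succ p _ ih =>
    obtain ⟨L', hL, hL'⟩ := ih (by omega)
    have hlt : L' < ⊤ := lt_top_iff_ne_top.2 fun h => by
      rw [h, finrank_top, Module.finrank_fin_fun] at hL'
      omega
    obtain ⟨x, -, hx⟩ := SetLike.exists_of_lt hlt
    refine ⟨L' ⊔ Submodule.span ℂ {x}, hL.trans le_sup_left, le_antisymm ?_ ?_⟩
    · have h1 := Submodule.finrank_add_le_finrank_add_finrank L' (Submodule.span ℂ {x})
      have h2 := finrank_span_le_card (R := ℂ) ({x} : Set (Fin n → ℂ))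
      simp only [Set.toFinset_singleton, Finset.card_singleton] at h2
      omega
    · have : L' < L' ⊔ Submodule.span ℂ {x} := left_lt_sup.2 fun h =>
        hx (h (Submodule.mem_span_singleton_self x))
      have := Submodule.finrank_lt_finrank_of_lt this
      omega

/-! ### The completely positive map of a pencil and its action on ranges -/

namespace MatrixPencil

variable {d n : ℕ}

theorem eta_apply (A : MatrixPencil d n) (X : Matrix (Fin n) (Fin n) ℂ) :
    A.eta X = ∑ i, A i * X * (A i)ᴴ := rfl

theorem eta_mul_conjTranspose (A : MatrixPencil d n) (C : Matrix (Fin n) (Fin n) ℂ) :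
    A.eta (C * Cᴴ) = ∑ i, (A i * C) * (A i * C)ᴴ := by
  simp [eta_apply, Matrix.mul_assoc]

theorem posSemidef_eta (A : MatrixPencil d n) {B : Matrix (Fin n) (Fin n) ℂ}
    (hB : B.PosSemidef) : (A.eta B).PosSemidef :=
  posSemidef_sum _ fun i _ => hB.mul_mul_conjTranspose_same (A i)

/-- The dictionary entry from which everything else follows: on positive semidefinite matrices,
`η_A` acts on ranges as the pencil acts on subspaces. -/
theorem range_eta (A : MatrixPencil d n) {B : Matrix (Fin n) (Fin n) ℂ} (hB : B.PosSemidef) :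
    LinearMap.range (toLin' (A.eta B)) =
      ⨆ i, (LinearMap.range (toLin' B)).map (toLin' (A i)) := by
  obtain ⟨C, rfl⟩ := hB.exists_eq_mul_conjTranspose
  rw [eta_mul_conjTranspose, ← blockRow_mul_conjTranspose, range_mul_conjTranspose_self,
    range_blockRow, range_mul_conjTranspose_self]
  simp [toLin'_mul, LinearMap.range_comp]

theorem isFull_iff_isRankNonDecreasing (A : MatrixPencil d n) :
    A.IsFull ↔ MatrixMap.IsRankNonDecreasing A.eta := by
  constructor
  · intro h B hB
    by_contra! hlt
    refine h ⟨LinearMap.range (toLin' B), LinearMap.range (toLin' (A.eta B)), fun i => ?_, hlt⟩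
    rw [A.range_eta hB]
    exact le_iSup (fun i => (LinearMap.range (toLin' B)).map (toLin' (A i))) i
  · rintro h ⟨R, L, hRL, hlt⟩
    obtain ⟨B, hB, rfl⟩ := exists_posSemidef_range_eq R
    have h1 : LinearMap.range (toLin' (A.eta B)) ≤ L := by
      rw [A.range_eta hB]; exact iSup_le hRL
    exact absurd (h B hB) (not_le.2 ((Submodule.finrank_mono h1).trans_lt hlt))

/-- If `V` identifies `ℂ^m` with the range of the projection `P` and intertwines the pencils `B`
and `A`, then `B` describes the corner of `η_A` at `P`. -/
theorem isCornerIndecomposable_eta_iff {m : ℕ} {A : MatrixPencil d n} {B : MatrixPencil d m}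
    {P : Matrix (Fin n) (Fin n) ℂ} (hP : IsStarProjection P)
    {V : Matrix (Fin n) (Fin m) ℂ} {W : Matrix (Fin m) (Fin n) ℂ}
    (hWV : W * V = 1) (hVW : V * W = P) (hAB : ∀ i, A i * V = V * B i) :
    MatrixMap.IsCornerIndecomposable P A.eta ↔ B.IsUnsplittable := by
  have hrank : P.rank = m := hVW ▸ rank_of_mul_eq_one hWV
  have hPV : P * V = V := by rw [← hVW, Matrix.mul_assoc, hWV, Matrix.mul_one]
  have hPadj : Pᴴ = P := hP.isSelfAdjoint
  have hPP : P * P = P := hP.isIdempotentElem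
  have hPAP : ∀ i, P * A i * P = V * B i * W := fun i => by
    rw [← hVW, Matrix.mul_assoc, ← Matrix.mul_assoc (A i), hAB, hVW, ← Matrix.mul_assoc,
      ← Matrix.mul_assoc, hPV]
  have hVinj : Function.Injective (toLin' V) := fun x y hxy => by
    have := congrArg (toLin' W) hxy
    simpa only [← LinearMap.comp_apply, ← toLin'_mul, hWV, toLin'_one, LinearMap.id_apply]
      using this
  have hPrange : LinearMap.range (toLin' P) = LinearMap.range (toLin' V) := by
    apply le_antisymm
    · rw [← hVW, toLin'_mul]; exact LinearMap.range_comp_le_range _ _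
    · rw [← hPV, toLin'_mul]; exact LinearMap.range_comp_le_range _ _
  -- compression to the corner changes nothing for a Hermitian matrix supported there
  have hcorner : ∀ X : Matrix (Fin n) (Fin n) ℂ, X.IsHermitian →
      LinearMap.range (toLin' X) ≤ LinearMap.range (toLin' V) → P * X * P = X := fun X hX hle => by
    have h1 : P * X = X := mul_eq_right_of_range_le hP.isIdempotentElem (hle.trans hPrange.ge)
    have h2 := congrArg conjTranspose h1
    rw [conjTranspose_mul, hPadj, hX.eq] at h2
    rw [h1, h2]
  have hmap : ∀ (R : Submodule ℂ (Fin m → ℂ)) (i : Fin d),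
      (R.map (toLin' V)).map (toLin' (A i)) = (R.map (toLin' (B i))).map (toLin' V) := fun R i => by
    rw [← Submodule.map_comp, ← Submodule.map_comp, ← toLin'_mul, ← toLin'_mul, hAB]
  have hfin : ∀ R : Submodule ℂ (Fin m → ℂ),
      Module.finrank ℂ (R.map (toLin' V)) = Module.finrank ℂ R := fun R =>
    (Submodule.equivMapOfInjective _ hVinj R).finrank_eq.symm
  refine and_congr ⟨?_, ?_⟩ ⟨?_, ?_⟩
  · rintro ⟨X, hX, hne⟩
    by_contra! hB
    refine hne ?_
    have : A.eta X = 0 := by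
      rw [eta_apply]
      refine Finset.sum_eq_zero fun i _ => ?_
      rw [← hX, ← hVW]
      simp [← Matrix.mul_assoc, hAB, hB]
    simp [this]
  · rintro ⟨i, hi⟩
    refine ⟨P, by rw [hPP, hPP], fun h0 => hi ?_⟩
    have h1 : ∑ i, (P * A i * P) * (P * A i * P)ᴴ = 0 := by
      rw [← h0, eta_apply, Finset.mul_sum, Finset.sum_mul]
      refine Finset.sum_congr rfl fun i _ => ?_
      simp only [conjTranspose_mul, hPadj, Matrix.mul_assoc]
      rw [← Matrix.mul_assoc P P, hPP]
    have h2 := eq_zero_of_sum_mul_conjTranspose_eq_zero h1 i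
    rw [hPAP] at h2
    have h3 : W * (V * B i * W) * V = B i := by
      rw [← Matrix.mul_assoc, ← Matrix.mul_assoc, hWV, Matrix.one_mul, Matrix.mul_assoc, hWV,
        Matrix.mul_one]
    rw [← h3, h2, Matrix.mul_zero, Matrix.zero_mul]
  · rintro h ⟨R, L, hdim, h1, hn, hRL⟩
    obtain ⟨X, hX, hXR⟩ := exists_posSemidef_range_eq (R.map (toLin' V))
    have hXrank : X.rank = Module.finrank ℂ R := by
      rw [← finrank_range_toLin', hXR, hfin]
    have hlt := h X (hcorner X hX.1 (hXR.le.trans LinearMap.map_le_range)) hX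
      (hXrank ▸ h1) (by rw [hXrank, hrank]; exact hn)
    have hle : (A.eta X).rank ≤ Module.finrank ℂ L := by
      rw [← finrank_range_toLin', A.range_eta hX, hXR, ← hfin L]
      refine Submodule.finrank_mono (iSup_le fun i => ?_)
      rw [hmap]
      exact Submodule.map_mono (hRL i)
    have h3 : (P * A.eta X * P).rank ≤ (A.eta X).rank :=
      (rank_mul_le_left _ _).trans (rank_mul_le_right _ _)
    omega
  · intro h X hPX hX h1 hlt
    by_contra! hle
    have hXV : LinearMap.range (toLin' X) ≤ LinearMap.range (toLin' V) := by
      rw [← hPrange, ← hPX, Matrix.mul_assoc, toLin'_mul]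
      exact LinearMap.range_comp_le_range _ _
    set R := (LinearMap.range (toLin' X)).comap (toLin' V) with hR
    have hRX : R.map (toLin' V) = LinearMap.range (toLin' X) := Submodule.map_comap_eq_self hXV
    have hRr : Module.finrank ℂ R = X.rank := by
      rw [← hfin, hRX, finrank_range_toLin']
    have hη : LinearMap.range (toLin' (A.eta X)) =
        (⨆ i, R.map (toLin' (B i))).map (toLin' V) := by
      rw [A.range_eta hX, ← hRX, Submodule.map_iSup]
      exact iSup_congr (hmap R)
    rw [hcorner _ (A.posSemidef_eta hX).1 (hη.le.trans LinearMap.map_le_range),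
      ← finrank_range_toLin' (A.eta X), hη, hfin] at hle
    obtain ⟨L, hL, hLr⟩ := Submodule.exists_ge_finrank_eq _ hle (by omega)
    exact h ⟨R, L, by rw [hRr, hLr], by omega, by omega,
      fun i => (le_iSup (fun i => R.map (toLin' (B i))) i).trans hL⟩

theorem isUnsplittable_iff_isIndecomposable (A : MatrixPencil d n) :
    A.IsUnsplittable ↔ MatrixMap.IsIndecomposable A.eta := by
  rw [← isCornerIndecomposable_eta_iff (A := A) (B := A) (P := 1) (V := 1) (W := 1)
    (IsStarProjection.one _) (by simp) (by simp) (by simp)]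
  have h : (∃ X, A.eta X ≠ 0) ↔ A.eta ≠ 0 := by
    rw [← not_iff_not]
    push Not
    exact ⟨fun h => LinearMap.ext h, fun h X => by rw [h]; rfl⟩
  simp [MatrixMap.IsCornerIndecomposable, MatrixMap.IsIndecomposable, h]

end MatrixPencil

/-! ### Minimax bounds for eigenvalues -/

namespace Matrix

variable {n : ℕ}

/-- Spectral theorem with the eigenvalues in decreasing order. -/
theorem IsHermitian.exists_unitary_antitone {M : Matrix (Fin n) (Fin n) ℂ}
    (hM : M.IsHermitian) :
    ∃ U ∈ unitaryGroup (Fin n) ℂ, ∃ μ : Fin n → ℝ, Antitone μ ∧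
      M = U * diagonal (fun i => (μ i : ℂ)) * Uᴴ := by
  set σ := Tuple.sort fun i => -hM.eigenvalues i
  obtain ⟨U₀, hU₀⟩ : ∃ U₀ : Matrix (Fin n) (Fin n) ℂ, U₀ = hM.eigenvectorUnitary := ⟨_, rfl⟩
  refine ⟨U₀.submatrix id σ, ?_, hM.eigenvalues ∘ σ, ?_, ?_⟩
  · rw [mem_unitaryGroup_iff, star_eq_conjTranspose, conjTranspose_submatrix,
      submatrix_mul_equiv _ _ _ σ, submatrix_id_id, ← star_eq_conjTranspose, hU₀]
    exact Unitary.mul_star_self_of_mem hM.eigenvectorUnitary.2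
  · intro i j hij
    exact neg_le_neg_iff.1 (Tuple.monotone_sort (fun i => -hM.eigenvalues i) hij)
  · have h : M = U₀ * diagonal (fun i => (hM.eigenvalues i : ℂ)) * U₀ᴴ := by
      rw [hU₀]; exact hM.spectral_theorem
    conv_lhs => rw [h]
    have hd : diagonal (fun i => (((hM.eigenvalues ∘ σ) i : ℝ) : ℂ)) =
        (diagonal fun i => (hM.eigenvalues i : ℂ)).submatrix σ σ := by
      rw [submatrix_diagonal_equiv]; rfl
    rw [hd, conjTranspose_submatrix, submatrix_mul_equiv _ _ _ σ, submatrix_mul_equiv _ _ _ σ,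
      submatrix_id_id]

theorem conjTranspose_mul_self_of_mem_unitaryGroup {U : Matrix (Fin n) (Fin n) ℂ}
    (hU : U ∈ unitaryGroup (Fin n) ℂ) : Uᴴ * U = 1 := mem_unitaryGroup_iff'.1 hU

theorem nonneg_of_posSemidef_conj_diagonal {U : Matrix (Fin n) (Fin n) ℂ}
    (hU : U ∈ unitaryGroup (Fin n) ℂ) {μ : Fin n → ℝ}
    (h : (U * diagonal (fun i => (μ i : ℂ)) * Uᴴ).PosSemidef) (i : Fin n) : 0 ≤ μ i := by
  have h1 := h.conjTranspose_mul_mul_same U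
  have hU' := conjTranspose_mul_self_of_mem_unitaryGroup hU
  have h2 : Uᴴ * (U * diagonal (fun i => (μ i : ℂ)) * Uᴴ) * U = diagonal fun i => (μ i : ℂ) := by
    rw [← Matrix.mul_assoc, ← Matrix.mul_assoc, hU', Matrix.one_mul, Matrix.mul_assoc, hU',
      Matrix.mul_one]
  rw [h2, posSemidef_diagonal_iff] at h1
  exact_mod_cast h1 i

theorem det_conj_diagonal {U : Matrix (Fin n) (Fin n) ℂ}
    (hU : U ∈ unitaryGroup (Fin n) ℂ) (μ : Fin n → ℝ) :
    (U * diagonal (fun i => (μ i : ℂ)) * Uᴴ).det = ((∏ i, μ i : ℝ) : ℂ) := by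
  rw [det_mul, det_mul, mul_right_comm, ← det_mul, ← star_eq_conjTranspose,
    mem_unitaryGroup_iff.1 hU, det_one, one_mul, det_diagonal]
  push_cast; rfl

theorem re_dotProduct_conj_diagonal (U : Matrix (Fin n) (Fin n) ℂ) (μ : Fin n → ℝ)
    (x : Fin n → ℂ) :
    (star x ⬝ᵥ (U * diagonal (fun i => (μ i : ℂ)) * Uᴴ) *ᵥ x).re =
      ∑ i, μ i * Complex.normSq ((Uᴴ *ᵥ x) i) := by
  have h : star x ⬝ᵥ (U * diagonal (fun i => (μ i : ℂ)) * Uᴴ) *ᵥ x =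
      star (Uᴴ *ᵥ x) ⬝ᵥ (diagonal fun i => (μ i : ℂ)) *ᵥ (Uᴴ *ᵥ x) := by
    rw [star_mulVec, conjTranspose_conjTranspose, ← dotProduct_mulVec, mulVec_mulVec,
      mulVec_mulVec]
  rw [h, dotProduct, Complex.re_sum]
  refine Finset.sum_congr rfl fun i _ => ?_
  rw [mulVec_diagonal]
  simp [Complex.normSq_apply]
  ring

theorem sum_normSq_unitary {U : Matrix (Fin n) (Fin n) ℂ} (hU : U ∈ unitaryGroup (Fin n) ℂ)
    (x : Fin n → ℂ) :
    ∑ i, Complex.normSq ((Uᴴ *ᵥ x) i) = ∑ i, Complex.normSq (x i) := by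
  have h1 := re_dotProduct_conj_diagonal U (fun _ => 1) x
  have h2 := re_dotProduct_conj_diagonal (1 : Matrix (Fin n) (Fin n) ℂ) (fun _ => 1) x
  have h3 : (diagonal fun _ : Fin n => ((1 : ℝ) : ℂ)) = 1 := by simp
  rw [h3] at h1 h2
  rw [Matrix.mul_one, ← star_eq_conjTranspose, mem_unitaryGroup_iff.1 hU] at h1
  simp only [conjTranspose_one, one_mulVec, one_mul] at h1 h2
  rw [← star_eq_conjTranspose, ← h1, h2]

/-- The minimax lower bound `μ_j ≥ t` for the `j`-th largest eigenvalue of `M`, counting from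
zero: the quadratic form of `M` is at least `t` on a subspace of dimension at least `j + 1`. -/
def EigenvalueGE (M : Matrix (Fin n) (Fin n) ℂ) (j : Fin n) (t : ℝ) : Prop :=
  ∃ V : Submodule ℂ (Fin n → ℂ), (j : ℕ) < Module.finrank ℂ V ∧
    ∀ x ∈ V, t * ∑ i, Complex.normSq (x i) ≤ (star x ⬝ᵥ M *ᵥ x).re

theorem EigenvalueGE.anti {M : Matrix (Fin n) (Fin n) ℂ} {j : Fin n} {s t : ℝ}
    (h : M.EigenvalueGE j t) (hst : s ≤ t) : M.EigenvalueGE j s := by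
  obtain ⟨V, hV, hx⟩ := h
  refine ⟨V, hV, fun x hxV => (mul_le_mul_of_nonneg_right hst ?_).trans (hx x hxV)⟩
  exact Finset.sum_nonneg fun i _ => Complex.normSq_nonneg _

theorem EigenvalueGE.le {U : Matrix (Fin n) (Fin n) ℂ} (hU : U ∈ unitaryGroup (Fin n) ℂ)
    {μ : Fin n → ℝ} (hμ : Antitone μ) {j : Fin n} {t : ℝ}
    (h : (U * diagonal (fun i => (μ i : ℂ)) * Uᴴ).EigenvalueGE j t) : t ≤ μ j := by
  obtain ⟨V, hV, hle⟩ := h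
  -- a nonzero vector of `V` orthogonal to the eigenvectors of the `j` largest eigenvalues
  let f : V →ₗ[ℂ] (Fin j → ℂ) :=
    LinearMap.funLeft ℂ ℂ (Fin.castLE j.2.le) ∘ₗ toLin' Uᴴ ∘ₗ V.subtype
  have hf : LinearMap.ker f ≠ ⊥ := LinearMap.ker_ne_bot_of_finrank_lt (by simpa using hV)
  obtain ⟨x, hx, hx0⟩ := Submodule.exists_mem_ne_zero_of_ne_bot hf
  have hy : ∀ i : Fin n, i < j → (Uᴴ *ᵥ (x : Fin n → ℂ)) i = 0 := fun i hi =>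
    congrFun (LinearMap.mem_ker.1 hx) ⟨i, hi⟩
  have h1 := hle x x.2
  rw [re_dotProduct_conj_diagonal, ← sum_normSq_unitary hU] at h1
  have hpos : 0 < ∑ i, Complex.normSq ((Uᴴ *ᵥ (x : Fin n → ℂ)) i) := by
    rw [sum_normSq_unitary hU]
    have hx0' : (x : Fin n → ℂ) ≠ 0 := fun h => hx0 (Subtype.ext h)
    obtain ⟨i, hi⟩ := Function.ne_iff.1 hx0'
    exact Finset.sum_pos' (fun i _ => Complex.normSq_nonneg _)
      ⟨i, Finset.mem_univ _, Complex.normSq_pos.2 hi⟩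
  refine le_of_mul_le_mul_right (h1.trans ?_) hpos
  rw [Finset.mul_sum]
  refine Finset.sum_le_sum fun i _ => ?_
  rcases lt_or_ge i j with hij | hij
  · simp [hy i hij]
  · exact mul_le_mul_of_nonneg_right (hμ hij) (Complex.normSq_nonneg _)

theorem eigenvalueGE_conj_diagonal {U : Matrix (Fin n) (Fin n) ℂ}
    (hU : U ∈ unitaryGroup (Fin n) ℂ) {μ : Fin n → ℝ} (hμ : Antitone μ) (j : Fin n) :
    (U * diagonal (fun i => (μ i : ℂ)) * Uᴴ).EigenvalueGE j (μ j) := by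
  -- the span of the eigenvectors of the `j + 1` largest eigenvalues
  let f : (Fin n → ℂ) →ₗ[ℂ] ({i : Fin n // j < i} → ℂ) :=
    LinearMap.funLeft ℂ ℂ Subtype.val ∘ₗ toLin' Uᴴ
  refine ⟨LinearMap.ker f, ?_, fun x hx => ?_⟩
  · have h1 := f.finrank_range_add_finrank_ker
    have h2 := (LinearMap.range f).finrank_le
    rw [Module.finrank_fintype_fun_eq_card, Fintype.card_subtype] at h2
    rw [Module.finrank_fin_fun] at h1
    have h3 : (Finset.univ.filter fun i : Fin n => j < i).card = n - 1 - j := by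
      rw [← Fin.card_Ioi]; congr 1; ext; simp
    have := j.2
    omega
  · have hy : ∀ i : Fin n, j < i → (Uᴴ *ᵥ x) i = 0 := fun i hi =>
      congrFun (LinearMap.mem_ker.1 hx) ⟨i, hi⟩
    rw [re_dotProduct_conj_diagonal, ← sum_normSq_unitary hU, Finset.mul_sum]
    refine Finset.sum_le_sum fun i _ => ?_
    rcases lt_or_ge j i with hij | hij
    · simp [hy i hij]
    · exact mul_le_mul_of_nonneg_right (hμ hij) (Complex.normSq_nonneg _)

theorem PosSemidef.prod_le_re_det {M : Matrix (Fin n) (Fin n) ℂ} (hM : M.PosSemidef)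
    {t : Fin n → ℝ} (ht : ∀ j, 0 ≤ t j) (h : ∀ j, M.EigenvalueGE j (t j)) :
    ∏ j, t j ≤ M.det.re := by
  obtain ⟨U, hU, μ, hμ, rfl⟩ := hM.1.exists_unitary_antitone
  rw [det_conj_diagonal hU, Complex.ofReal_re]
  exact Finset.prod_le_prod (fun j _ => ht j) fun j _ => (h j).le hU hμ

theorem PosSemidef.exists_eigenvalueGE_of_lt_rank {M : Matrix (Fin n) (Fin n) ℂ}
    (hM : M.PosSemidef) {j : Fin n} (hj : (j : ℕ) < M.rank) :
    ∃ c : ℝ, 0 < c ∧ M.EigenvalueGE j c := by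
  obtain ⟨U, hU, μ, hμ, rfl⟩ := hM.1.exists_unitary_antitone
  have hnn := nonneg_of_posSemidef_conj_diagonal hU hM
  refine ⟨μ j, (hnn j).lt_of_ne fun h0 => ?_, eigenvalueGE_conj_diagonal hU hμ j⟩
  have h1 : (U * diagonal (fun i => (μ i : ℂ)) * Uᴴ).rank ≤
      (diagonal fun i => (μ i : ℂ)).rank :=
    (rank_mul_le_left _ _).trans (rank_mul_le_right _ _)
  rw [rank_diagonal, Fintype.card_subtype] at h1
  have h2 : (Finset.univ.filter fun i : Fin n => (μ i : ℂ) ≠ 0) ⊆ Finset.Iio j := fun i hi => by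
    rw [Finset.mem_Iio]
    by_contra! hij
    have : μ i = 0 := le_antisymm (h0 ▸ hμ hij) (hnn i)
    simp [this] at hi
  have h3 := Finset.card_le_card h2
  rw [Fin.card_Iio] at h3
  omega

/-- Eigenvalues are lower semicontinuous, with an explicit modulus. -/
theorem EigenvalueGE.sub_of_entries {M N : Matrix (Fin n) (Fin n) ℂ} {j : Fin n} {t : ℝ}
    (h : M.EigenvalueGE j t) : N.EigenvalueGE j (t - ∑ a, ∑ b, ‖(M - N) a b‖) := by
  obtain ⟨V, hV, hle⟩ := h
  refine ⟨V, hV, fun x hx => ?_⟩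
  have hentry : ∀ a, ‖x a‖ ^ 2 ≤ ∑ i, Complex.normSq (x i) := fun a => by
    rw [← Complex.normSq_eq_norm_sq]
    exact Finset.single_le_sum (f := fun i => Complex.normSq (x i))
      (fun i _ => Complex.normSq_nonneg _) (Finset.mem_univ a)
  have h1 : (star x ⬝ᵥ (M - N) *ᵥ x).re ≤
      (∑ a, ∑ b, ‖(M - N) a b‖) * ∑ i, Complex.normSq (x i) := by
    refine (Complex.re_le_norm _).trans ?_
    simp only [dotProduct, mulVec]
    rw [Finset.sum_mul]
    refine (norm_sum_le _ _).trans (Finset.sum_le_sum fun a _ => ?_)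
    rw [Finset.sum_mul, Finset.mul_sum]
    refine (norm_sum_le _ _).trans (Finset.sum_le_sum fun b _ => ?_)
    rw [norm_mul, norm_mul, Pi.star_apply, norm_star, mul_left_comm]
    refine mul_le_mul_of_nonneg_left ?_ (norm_nonneg _)
    nlinarith [hentry a, hentry b, sq_nonneg (‖x a‖ - ‖x b‖)]
  have h2 := hle x hx
  rw [sub_mulVec, dotProduct_sub, Complex.sub_re] at h1
  linarith

theorem EigenvalueGE.mono {M N : Matrix (Fin n) (Fin n) ℂ} {j : Fin n} {s t : ℝ}
    (h : M.EigenvalueGE j t) (hs : 0 ≤ s) (hMN : (N - (s : ℂ) • M).PosSemidef) :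
    N.EigenvalueGE j (s * t) := by
  obtain ⟨V, hV, hle⟩ := h
  refine ⟨V, hV, fun x hx => ?_⟩
  have h1 : 0 ≤ (star x ⬝ᵥ (N - (s : ℂ) • M) *ᵥ x).re := hMN.re_dotProduct_nonneg x
  rw [sub_mulVec, dotProduct_sub, smul_mulVec, dotProduct_smul, smul_eq_mul, Complex.sub_re,
    Complex.re_ofReal_mul] at h1
  nlinarith [hle x hx, mul_le_mul_of_nonneg_left (hle x hx) hs]

theorem posSemidef_conj_diagonal_sub_smul (U : Matrix (Fin n) (Fin n) ℂ) {μ : Fin n → ℝ}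
    (hμ : Antitone μ) (hnn : ∀ i, 0 ≤ μ i) (j : Fin n) :
    (U * diagonal (fun i => (μ i : ℂ)) * Uᴴ -
      (μ j : ℂ) • (U * diagonal (fun i => if i ≤ j then 1 else 0) * Uᴴ)).PosSemidef := by
  have h : U * diagonal (fun i => (μ i : ℂ)) * Uᴴ -
      (μ j : ℂ) • (U * diagonal (fun i => if i ≤ j then 1 else 0) * Uᴴ) =
      U * diagonal (fun i => ((μ i - if i ≤ j then μ j else 0 : ℝ) : ℂ)) * Uᴴ := by
    rw [← Matrix.smul_mul, ← Matrix.mul_smul, ← Matrix.sub_mul, ← Matrix.mul_sub,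
      ← diagonal_smul, diagonal_sub]
    congr 3
    ext i
    simp only [Pi.smul_apply, smul_eq_mul]
    split_ifs <;> simp
  rw [h]
  refine (PosSemidef.diagonal fun i => ?_).mul_mul_conjTranspose_same U
  rw [Pi.zero_apply, ← Complex.ofReal_zero, Complex.real_le_real, sub_nonneg]
  split_ifs with hij
  · exact hμ hij
  · exact hnn i

theorem isCompact_unitaryGroup :
    IsCompact (unitaryGroup (Fin n) ℂ : Set (Matrix (Fin n) (Fin n) ℂ)) := by
  have hK : IsCompact (Set.univ.pi fun _ : Fin n => Set.univ.pi fun _ : Fin n =>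
      Metric.closedBall (0 : ℂ) 1) :=
    isCompact_univ_pi fun _ => isCompact_univ_pi fun _ => isCompact_closedBall 0 1
  refine IsCompact.of_isClosed_subset hK ?_ fun U hU a _ b _ => ?_
  · have : (unitaryGroup (Fin n) ℂ : Set (Matrix (Fin n) (Fin n) ℂ)) = {U | U * star U = 1} :=
      Set.ext fun U => mem_unitaryGroup_iff
    rw [this]
    exact isClosed_eq (by fun_prop) continuous_const
  · rw [mem_closedBall_zero_iff]
    exact entry_norm_bound_of_unitary hU a b

/-- A continuous family of positive semidefinite matrices over a compact set, all of rank greater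
than `j`, has its `j`-th eigenvalues bounded away from zero. -/
theorem exists_forall_eigenvalueGE {X : Type*} [TopologicalSpace X] {K : Set X}
    (hK : IsCompact K) {N : X → Matrix (Fin n) (Fin n) ℂ} (hN : Continuous N)
    (hpsd : ∀ x ∈ K, (N x).PosSemidef) {j : Fin n} (hj : ∀ x ∈ K, (j : ℕ) < (N x).rank) :
    ∃ c : ℝ, 0 < c ∧ ∀ x ∈ K, (N x).EigenvalueGE j c := by
  refine hK.induction_on (p := fun s => ∃ c : ℝ, 0 < c ∧ ∀ x ∈ s, (N x).EigenvalueGE j c)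
    ⟨1, one_pos, by simp⟩ ?_ ?_ ?_
  · rintro s t hst ⟨c, hc, h⟩
    exact ⟨c, hc, fun x hx => h x (hst hx)⟩
  · rintro s t ⟨c, hc, h⟩ ⟨c', hc', h'⟩
    refine ⟨min c c', lt_min hc hc', ?_⟩
    rintro x (hx | hx)
    · exact (h x hx).anti (min_le_left _ _)
    · exact (h' x hx).anti (min_le_right _ _)
  · intro x hx
    obtain ⟨c, hc, h⟩ := (hpsd x hx).exists_eigenvalueGE_of_lt_rank (hj x hx)
    have hcont : Continuous fun y => ∑ a, ∑ b, ‖(N x - N y) a b‖ :=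
      continuous_finsetSum _ fun a _ => continuous_finsetSum _ fun b _ =>
        ((continuous_const.sub hN).matrix_elem a b).norm
    have hmem : {y | ∑ a, ∑ b, ‖(N x - N y) a b‖ < c / 2} ∈ nhds x := by
      refine (isOpen_lt hcont continuous_const).mem_nhds ?_
      simpa using hc
    refine ⟨_, mem_nhdsWithin_of_mem_nhds hmem, c / 2, half_pos hc, fun y hy => ?_⟩
    refine (h.sub_of_entries (N := N y)).anti ?_
    have : ∑ a, ∑ b, ‖(N x - N y) a b‖ < c / 2 := hy
    linarith

/-- With `P = V * W` idempotent of rank `r`, the matrix `a • P + b • (1 - P)` has eigenvalue `a`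
with multiplicity `r` and eigenvalue `b` otherwise. -/
theorem det_smul_add_smul_one_sub {r : ℕ} {V : Matrix (Fin n) (Fin r) ℂ}
    {W : Matrix (Fin r) (Fin n) ℂ} (hWV : W * V = 1) (hr : r ≤ n) {a b : ℂ} (hb : b ≠ 0) :
    (a • (V * W) + b • (1 - V * W)).det = a ^ r * b ^ (n - r) := by
  have h1 : a • (V * W) + b • (1 - V * W) = b • (1 + (((a - b) / b) • V) * W) := by
    rw [Matrix.smul_mul, smul_add, smul_smul, mul_div_cancel₀ _ hb, sub_smul, smul_sub]
    abel
  have h2 : (1 : Matrix (Fin r) (Fin r) ℂ) + W * (((a - b) / b) • V) = (a / b) • 1 := by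
    rw [Matrix.mul_smul, hWV]
    nth_rewrite 1 [← one_smul ℂ (1 : Matrix (Fin r) (Fin r) ℂ)]
    rw [← add_smul]
    congr 1
    field_simp
    ring
  rw [h1, det_smul, det_one_add_mul_comm, h2, det_smul, det_one, Fintype.card_fin,
    Fintype.card_fin, mul_one, div_pow, ← Nat.sub_add_cancel hr, pow_add, Nat.add_sub_cancel]
  field_simp

end Matrix

/-! ### Capacity -/

namespace MatrixPencil

variable {d n : ℕ}

theorem continuous_eta (A : MatrixPencil d n) : Continuous A.eta := by
  change Continuous fun X => ∑ i, A i * X * (A i)ᴴ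
  exact continuous_finsetSum _ fun i _ =>
    (continuous_const.matrix_mul continuous_id).matrix_mul continuous_const

theorem re_det_eta_nonneg (A : MatrixPencil d n) {B : Matrix (Fin n) (Fin n) ℂ}
    (hB : B.PosSemidef) : 0 ≤ (A.eta B).det.re :=
  (Complex.le_def.1 (A.posSemidef_eta hB).det_nonneg).1

theorem ofReal_re_det_eta (A : MatrixPencil d n) {B : Matrix (Fin n) (Fin n) ℂ}
    (hB : B.PosSemidef) : (A.eta B).det = ((A.eta B).det.re : ℂ) := by
  have h := (Complex.le_def.1 (A.posSemidef_eta hB).det_nonneg).2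
  exact Complex.ext rfl (by simpa using h.symm)

/-- If `η_A` is rank non-decreasing then `det (η_A B)` is bounded below by a positive constant
over all positive definite `B` of determinant one. Write `λ₀ ≥ λ₁ ≥ ⋯` for the eigenvalues of `B`
and `E_j` for the projection onto the span of its first `j + 1` eigenvectors. From `B ≥ λ_j E_j`
and `rank (η_A E_j) > j` the `j`-th eigenvalue of `η_A B` is at least `c λ_j`, with `c` uniform by
compactness of the unitary group, so `det (η_A B) ≥ c ^ n * det B`. -/
theorem exists_pos_le_det_eta {A : MatrixPencil d n}
    (h : MatrixMap.IsRankNonDecreasing A.eta) :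
    ∃ c : ℝ, 0 < c ∧ ∀ B : Matrix (Fin n) (Fin n) ℂ, B.PosDef → B.det = 1 →
      c ≤ (A.eta B).det.re := by
  let E : Fin n → Matrix (Fin n) (Fin n) ℂ := fun j => diagonal fun i => if i ≤ j then 1 else 0
  have hE : ∀ j, (E j).PosSemidef := fun j => PosSemidef.diagonal fun i => by
    change (0 : ℂ) ≤ if i ≤ j then 1 else 0
    split_ifs <;> simp
  have hrank : ∀ j : Fin n, ∀ U ∈ unitaryGroup (Fin n) ℂ, (j : ℕ) < (A.eta (U * E j * Uᴴ)).rank := by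
    intro j U hU
    have h1 := h _ ((hE j).mul_mul_conjTranspose_same U)
    have hUU := conjTranspose_mul_self_of_mem_unitaryGroup hU
    have h2 : (E j).rank ≤ (U * E j * Uᴴ).rank := by
      have h3 : Uᴴ * (U * E j * Uᴴ) * U = E j := by
        rw [← Matrix.mul_assoc, ← Matrix.mul_assoc, hUU, Matrix.one_mul, Matrix.mul_assoc, hUU,
          Matrix.mul_one]
      conv_lhs => rw [← h3]
      exact (rank_mul_le_left _ _).trans (rank_mul_le_right _ _)
    have h3 : (E j).rank = j + 1 := by
      rw [rank_diagonal, Fintype.card_subtype, ← Fin.card_Iic]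
      congr 1
      ext i
      simp
    omega
  choose c hc hcE using fun j => exists_forall_eigenvalueGE (j := j) isCompact_unitaryGroup
    (N := fun U => A.eta (U * E j * Uᴴ))
    (A.continuous_eta.comp ((continuous_id.matrix_mul continuous_const).matrix_mul
      continuous_id.matrix_conjTranspose))
    (fun U _ => A.posSemidef_eta ((hE j).mul_mul_conjTranspose_same U)) (hrank j)
  refine ⟨∏ j, c j, Finset.prod_pos fun j _ => hc j, fun B hB hdet => ?_⟩
  obtain ⟨U, hU, μ, hμ, rfl⟩ := hB.1.exists_unitary_antitone
  have hnn := nonneg_of_posSemidef_conj_diagonal hU hB.posSemidef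
  have hprod : ∏ j, μ j = 1 := by
    rw [det_conj_diagonal hU] at hdet
    exact_mod_cast hdet
  have hge : ∀ j, (A.eta (U * diagonal (fun i => (μ i : ℂ)) * Uᴴ)).EigenvalueGE j
      (μ j * c j) := fun j => by
    have h1 : (A.eta (U * E j * Uᴴ)).EigenvalueGE j (c j) := hcE j U hU
    have h2 := A.posSemidef_eta (posSemidef_conj_diagonal_sub_smul U hμ hnn j)
    rw [map_sub, map_smul] at h2
    exact h1.mono (hnn j) h2
  have hdet' := (A.posSemidef_eta hB.posSemidef).prod_le_re_det
    (fun j => mul_nonneg (hnn j) (hc j).le) hge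
  rwa [Finset.prod_mul_distrib, hprod, one_mul] at hdet'

/-- If `η_A` is not rank non-decreasing, `det (η_A B)` takes arbitrarily small values. Let `A` map
the range of an idempotent `P` of rank `r` into that of an idempotent `Q` of rank `l < r`. The
matrices `D₂ t = t ^ (-(n - r)) P + t ^ r (1 - P)` have determinant one; on the other side
`D₁ t = t ^ (n - r) Q + t ^ (-r) (1 - Q)` keeps `D₁ A D₂` bounded as `t → 0`, while its determinant
`t ^ (-n (r - l))` tends to infinity. -/
theorem exists_det_eta_lt {A : MatrixPencil d n} (h : ¬ A.IsFull) {ε : ℝ} (hε : 0 < ε) :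
    ∃ B : Matrix (Fin n) (Fin n) ℂ, B.PosDef ∧ B.det = 1 ∧ (A.eta B).det.re < ε := by
  rw [IsFull, not_not] at h
  obtain ⟨R, L, hRL, hlt⟩ := h
  obtain ⟨r, hr⟩ : ∃ r, Module.finrank ℂ R = r := ⟨_, rfl⟩
  obtain ⟨l, hl⟩ : ∃ l, Module.finrank ℂ L = l := ⟨_, rfl⟩
  have hrn : r ≤ n := by simpa [hr] using R.finrank_le
  rw [hr, hl] at hlt
  obtain ⟨V, W, hWV, hV⟩ := exists_mul_eq_one_range_eq R hr
  obtain ⟨V', W', hWV', hV'⟩ := exists_mul_eq_one_range_eq L hl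
  set P := V * W with hP
  set Q := V' * W' with hQ
  have hQidem : IsIdempotentElem Q := by
    rw [IsIdempotentElem, hQ, Matrix.mul_assoc, ← Matrix.mul_assoc W', hWV', Matrix.one_mul]
  have hQAP : ∀ i, (1 - Q) * A i * P = 0 := fun i => by
    have h1 : Q * (A i * V) = A i * V := by
      refine mul_eq_right_of_range_le hQidem ?_
      rw [toLin'_mul, LinearMap.range_comp, hV]
      refine (hRL i).trans ?_
      rw [← hV', show V' = Q * V' by rw [hQ, Matrix.mul_assoc, hWV', Matrix.mul_one], toLin'_mul]
      exact LinearMap.range_comp_le_range _ _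
    rw [hP, ← Matrix.mul_assoc, Matrix.mul_assoc (1 - Q), Matrix.sub_mul, h1, Matrix.one_mul,
      sub_self, Matrix.zero_mul]
  let G : ℝ → Matrix (Fin n) (Fin n) ℂ := fun t => ∑ i,
    (Q * A i * P + ((t : ℂ) ^ n) • (Q * A i * (1 - P)) + (1 - Q) * A i * (1 - P)) *
      (Q * A i * P + ((t : ℂ) ^ n) • (Q * A i * (1 - P)) + (1 - Q) * A i * (1 - P))ᴴ
  let D₁ : ℝ → Matrix (Fin n) (Fin n) ℂ := fun t =>
    ((t : ℂ) ^ (n - r)) • Q + (((t : ℂ) ^ r)⁻¹) • (1 - Q)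
  let D₂ : ℝ → Matrix (Fin n) (Fin n) ℂ := fun t =>
    (((t : ℂ) ^ (n - r))⁻¹) • P + ((t : ℂ) ^ r) • (1 - P)
  have hD₂ : ∀ t : ℝ, 0 < t → (D₂ t).det = 1 := fun t ht => by
    have ht' : (t : ℂ) ≠ 0 := by exact_mod_cast ht.ne'
    rw [det_smul_add_smul_one_sub hWV hrn (pow_ne_zero _ ht'), inv_pow, ← pow_mul, ← pow_mul,
      mul_comm r, inv_mul_cancel₀ (pow_ne_zero _ ht')]
  have hD₁ : ∀ t : ℝ, 0 < t → (t : ℂ) ^ (n * (r - l)) * (D₁ t).det = 1 := fun t ht => by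
    have ht' : (t : ℂ) ≠ 0 := by exact_mod_cast ht.ne'
    rw [det_smul_add_smul_one_sub hWV' (by omega) (inv_ne_zero (pow_ne_zero _ ht')), inv_pow,
      ← pow_mul, ← pow_mul, ← mul_assoc, ← pow_add]
    have hexp : n * (r - l) + (n - r) * l = r * (n - l) := by
      obtain ⟨p, rfl⟩ := Nat.exists_eq_add_of_le hlt.le
      obtain ⟨q, rfl⟩ := Nat.exists_eq_add_of_le hrn
      have e1 : l + p - l = p := by omega
      have e2 : l + p + q - (l + p) = q := by omega
      have e3 : l + p + q - l = p + q := by omega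
      rw [e1, e2, e3]; ring
    rw [hexp, mul_inv_cancel₀ (pow_ne_zero _ ht')]
  have hDAD : ∀ t : ℝ, 0 < t → ∀ i, D₁ t * A i * D₂ t =
      Q * A i * P + ((t : ℂ) ^ n) • (Q * A i * (1 - P)) + (1 - Q) * A i * (1 - P) := by
    intro t ht i
    have ht' : (t : ℂ) ≠ 0 := by exact_mod_cast ht.ne'
    simp only [D₁, D₂, Matrix.add_mul, Matrix.mul_add, Matrix.smul_mul, Matrix.mul_smul,
      smul_add, smul_smul, hQAP, smul_zero, add_zero]
    rw [inv_mul_cancel₀ (pow_ne_zero _ ht'), mul_inv_cancel₀ (pow_ne_zero _ ht'), one_smul,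
      one_smul, ← pow_add, Nat.add_sub_cancel' hrn]
    abel
  have hG : ∀ t : ℝ, 0 < t → D₁ t * A.eta (D₂ t * (D₂ t)ᴴ) * (D₁ t)ᴴ = G t := fun t ht => by
    rw [eta_mul_conjTranspose, Finset.mul_sum, Finset.sum_mul]
    refine Finset.sum_congr rfl fun i _ => ?_
    rw [← hDAD t ht i]
    simp [Matrix.mul_assoc]
  have hdet : ∀ t : ℝ, 0 < t → (A.eta (D₂ t * (D₂ t)ᴴ)).det =
      ((t : ℂ) ^ (n * (r - l))) ^ 2 * (G t).det := fun t ht => by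
    have h1 := hD₁ t ht
    have h2 := congrArg star h1
    rw [star_mul', star_one, star_pow, Complex.star_def, Complex.conj_ofReal,
      ← Complex.star_def, ← det_conjTranspose] at h2
    rw [← hG t ht, det_mul, det_mul]
    linear_combination (-(A.eta (D₂ t * (D₂ t)ᴴ)).det) * h1 -
      (A.eta (D₂ t * (D₂ t)ᴴ)).det * (t : ℂ) ^ (n * (r - l)) * (D₁ t).det * h2
  have hcont : Continuous fun t : ℝ => (((t : ℂ) ^ (n * (r - l))) ^ 2 * (G t).det).re := by
    have : Continuous G := by
      refine continuous_finsetSum _ fun i _ => ?_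
      fun_prop
    fun_prop
  have hzero : (((((0 : ℝ) : ℂ)) ^ (n * (r - l))) ^ 2 * (G 0).det).re = 0 := by
    have : n * (r - l) ≠ 0 := Nat.mul_ne_zero (by omega) (by omega)
    simp [this]
  have hev : ∀ᶠ t : ℝ in nhdsWithin 0 (Set.Ioi 0),
      (((t : ℂ) ^ (n * (r - l))) ^ 2 * (G t).det).re < ε :=
    (hcont.continuousAt.eventually_lt continuousAt_const
      (by rw [hzero]; exact hε)).filter_mono nhdsWithin_le_nhds
  obtain ⟨t, hlt', ht⟩ := (hev.and self_mem_nhdsWithin).exists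
  refine ⟨D₂ t * (D₂ t)ᴴ, ?_, ?_, ?_⟩
  · refine PosDef.mul_conjTranspose_self _ (vecMul_injective_iff_isUnit.2 ?_)
    rw [isUnit_iff_isUnit_det, hD₂ t ht]
    exact isUnit_one
  · rw [det_mul, det_conjTranspose, hD₂ t ht, star_one, one_mul]
  · rw [hdet t ht]; exact hlt'

theorem isRankNonDecreasing_iff_capacity_pos (A : MatrixPencil d n) :
    MatrixMap.IsRankNonDecreasing A.eta ↔ 0 < MatrixMap.capacity A.eta := by
  constructor
  · intro h
    obtain ⟨c, hc, hle⟩ := exists_pos_le_det_eta h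
    refine hc.trans_le (le_csInf ?_ ?_)
    · exact ⟨_, 1, PosDef.one, det_one, A.ofReal_re_det_eta PosSemidef.one⟩
    · rintro t ⟨B, hB, hdet, ht⟩
      have := hle B hB hdet
      rwa [ht, Complex.ofReal_re] at this
  · intro h
    rw [← isFull_iff_isRankNonDecreasing]
    by_contra hfull
    obtain ⟨B, hB, hdet, hlt⟩ := exists_det_eta_lt hfull h
    refine hlt.not_ge (csInf_le ⟨0, ?_⟩ ⟨B, hB, hdet, A.ofReal_re_det_eta hB.posSemidef⟩)
    rintro t ⟨B', hB', -, ht⟩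
    have := A.re_det_eta_nonneg hB'.posSemidef
    rwa [ht, Complex.ofReal_re] at this

end MatrixPencil

/-! ### Block diagonalization and diagonal subalgebras -/

namespace MatrixPencil

variable {d n : ℕ}

theorem scaling_eta (c₁ c₂ : Matrix (Fin n) (Fin n) ℂ) (A : MatrixPencil d n) :
    MatrixMap.scaling c₁ c₂ A.eta = MatrixPencil.eta fun i => c₁ * A i * c₂ᴴ := by
  refine LinearMap.ext fun X => ?_
  change c₁ * (∑ i, A i * (c₂ᴴ * X * c₂) * (A i)ᴴ) * c₁ᴴ =
    ∑ i, c₁ * A i * c₂ᴴ * X * (c₁ * A i * c₂ᴴ)ᴴ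
  simp [Finset.mul_sum, Finset.sum_mul, Matrix.mul_assoc]

/-- For a family of projections, bimodularity of `η_A` over their span says that the pencil
commutes with every projection. -/
theorem isBimodular_eta_iff {k : ℕ} {P : Fin k → Matrix (Fin n) (Fin n) ℂ}
    (hP : MatrixMap.IsProjectionFamily P) (A : MatrixPencil d n) :
    MatrixMap.IsBimodular P A.eta ↔ ∀ i j, A i * P j = P j * A i := by
  obtain ⟨hproj, horth, hsum⟩ := hP
  have hadj : ∀ j, (P j)ᴴ = P j := fun j => (hproj j).isSelfAdjoint
  constructor
  · intro h
    -- `P l * η (P j) * P l = η (P l * P j * P l) = 0` is a sum of squares of the `P l * A i * P j`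
    have hoff : ∀ i j l, l ≠ j → P l * A i * P j = 0 := fun i j l hlj => by
      have h0 := h (P l) (Submodule.subset_span ⟨l, rfl⟩) (P l) (Submodule.subset_span ⟨l, rfl⟩)
        (P j)
      rw [horth hlj, Matrix.zero_mul, map_zero] at h0
      refine eq_zero_of_sum_mul_conjTranspose_eq_zero (M := fun i => P l * A i * P j) ?_ i
      rw [h0, eta_apply, Finset.mul_sum, Finset.sum_mul]
      refine Finset.sum_congr rfl fun i _ => ?_
      simp only [conjTranspose_mul, hadj, Matrix.mul_assoc]
      rw [← Matrix.mul_assoc (P j) (P j), (hproj j).isIdempotentElem.eq]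
    intro i j
    calc A i * P j = (∑ l, P l) * A i * P j := by rw [hsum, Matrix.one_mul]
      _ = P j * A i * P j := by
        rw [Finset.sum_mul, Finset.sum_mul]
        exact Finset.sum_eq_single j (fun l _ hl => hoff i j l hl) (by simp)
      _ = P j * A i * ∑ l, P l := by
        rw [Finset.mul_sum]
        exact (Finset.sum_eq_single j (fun l _ hl => hoff i l j hl.symm) (by simp)).symm
      _ = P j * A i := by rw [hsum, Matrix.mul_one]
  · intro h D₁ hD₁ D₂ hD₂ X
    have h1 : ∀ i, A i * D₁ = D₁ * A i := fun i => by
      induction hD₁ using Submodule.span_induction with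
      | mem _ hx => obtain ⟨j, rfl⟩ := hx; exact h i j
      | zero => simp
      | add x y _ _ hx hy => rw [Matrix.mul_add, Matrix.add_mul, hx, hy]
      | smul c x _ hx => rw [Matrix.mul_smul, Matrix.smul_mul, hx]
    have h2 : ∀ i, D₂ * (A i)ᴴ = (A i)ᴴ * D₂ := fun i => by
      induction hD₂ using Submodule.span_induction with
      | mem _ hx =>
        obtain ⟨j, rfl⟩ := hx
        simpa [hadj] using (congrArg conjTranspose (h i j))
      | zero => simp
      | add x y _ _ hx hy => rw [Matrix.mul_add, Matrix.add_mul, hx, hy]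
      | smul c x _ hx => rw [Matrix.mul_smul, Matrix.smul_mul, hx]
    rw [eta_apply, eta_apply, Finset.mul_sum, Finset.sum_mul]
    refine Finset.sum_congr rfl fun i _ => ?_
    rw [← Matrix.mul_assoc, ← Matrix.mul_assoc, h1, Matrix.mul_assoc _ D₂, h2]
    simp only [Matrix.mul_assoc]

/-- The inclusion of the `j`-th block of coordinates. -/
def blockIncl {k : ℕ} {m : Fin k → ℕ} (e : (Σ j, Fin (m j)) ≃ Fin n) (j : Fin k) :
    Matrix (Fin n) (Fin (m j)) ℂ :=
  Matrix.of fun a y => if a = e ⟨j, y⟩ then 1 else 0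

section blockIncl

variable {k : ℕ} {m : Fin k → ℕ} (e : (Σ j, Fin (m j)) ≃ Fin n)

theorem blockIncl_conjTranspose_mul_self (j : Fin k) :
    (blockIncl e j)ᴴ * blockIncl e j = 1 := by
  ext x y
  simp [blockIncl, Matrix.mul_apply, Matrix.one_apply, eq_comm]

theorem blockIncl_conjTranspose_mul_of_ne {j l : Fin k} (h : j ≠ l) :
    (blockIncl e j)ᴴ * blockIncl e l = 0 := by
  ext x y
  simp [blockIncl, Matrix.mul_apply, h.symm]

theorem sum_blockIncl_mul_conjTranspose :
    ∑ j, blockIncl e j * (blockIncl e j)ᴴ = 1 := by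
  ext a b
  obtain ⟨a, rfl⟩ := e.surjective a
  obtain ⟨b, rfl⟩ := e.surjective b
  have h : ∀ p q : Σ j, Fin (m j),
      (∑ j, blockIncl e j * (blockIncl e j)ᴴ) (e p) (e q) =
        ∑ r : Σ j, Fin (m j), (if p = r then 1 else 0) * (if q = r then 1 else 0) := by
    intro p q
    rw [Fintype.sum_sigma, Matrix.sum_apply]
    refine Finset.sum_congr rfl fun j _ => ?_
    simp [blockIncl, Matrix.mul_apply]
  rw [h]
  simp [Matrix.one_apply]

theorem reindex_blockDiagonal'_mul_blockIncl (B : ∀ j, Matrix (Fin (m j)) (Fin (m j)) ℂ)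
    (j : Fin k) :
    Matrix.reindex e e (Matrix.blockDiagonal' B) * blockIncl e j = blockIncl e j * B j := by
  ext a y
  obtain ⟨⟨l, x⟩, rfl⟩ := e.surjective a
  by_cases h : l = j
  · subst h
    simp [blockIncl, Matrix.mul_apply]
  · simp [blockIncl, Matrix.mul_apply, h, Matrix.blockDiagonal'_apply_ne]

theorem conjTranspose_blockIncl_mul_reindex_blockDiagonal'
    (B : ∀ j, Matrix (Fin (m j)) (Fin (m j)) ℂ) (j : Fin k) :
    (blockIncl e j)ᴴ * Matrix.reindex e e (Matrix.blockDiagonal' B) =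
      B j * (blockIncl e j)ᴴ := by
  have h := reindex_blockDiagonal'_mul_blockIncl e (fun j => (B j)ᴴ) j
  have h2 := congrArg conjTranspose h
  simpa only [conjTranspose_mul, conjTranspose_conjTranspose, conjTranspose_reindex,
    blockDiagonal'_conjTranspose] using h2

end blockIncl

theorem exists_isDCI_of_isLRSemisimple {A : MatrixPencil d n} (h : A.IsLRSemisimple) :
    ∃ (c₁ c₂ : GL (Fin n) ℂ) (k : ℕ) (P : Fin k → Matrix (Fin n) (Fin n) ℂ),
      MatrixMap.IsDCI P (MatrixMap.scaling (c₁ : Matrix (Fin n) (Fin n) ℂ)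
        (c₂ : Matrix (Fin n) (Fin n) ℂ) A.eta) := by
  obtain ⟨L, R, k, m, hm, B, hB, hunsplit⟩ := h
  refine ⟨L, star R, k, fun j =>
    blockIncl (finSigmaFinEquiv.trans (finCongr hm)) j *
      (blockIncl (finSigmaFinEquiv.trans (finCongr hm)) j)ᴴ, ?_⟩
  have hR : ((star R : GL (Fin n) ℂ) : Matrix (Fin n) (Fin n) ℂ)ᴴ = R := by
    rw [Units.coe_star, star_eq_conjTranspose, conjTranspose_conjTranspose]
  rw [scaling_eta, hR]
  simp only [hB]
  set e := finSigmaFinEquiv.trans (finCongr hm)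
  have hproj : ∀ j, IsStarProjection (blockIncl e j * (blockIncl e j)ᴴ) := fun j => by
    constructor
    · rw [IsIdempotentElem, Matrix.mul_assoc, ← Matrix.mul_assoc _ (blockIncl e j),
        blockIncl_conjTranspose_mul_self, Matrix.one_mul]
    · exact isHermitian_mul_conjTranspose_self _
  have hfam : MatrixMap.IsProjectionFamily fun j => blockIncl e j * (blockIncl e j)ᴴ := by
    refine ⟨hproj, fun j l hjl => ?_, sum_blockIncl_mul_conjTranspose e⟩
    change blockIncl e j * (blockIncl e j)ᴴ * (blockIncl e l * (blockIncl e l)ᴴ) = 0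
    rw [Matrix.mul_assoc, ← Matrix.mul_assoc _ (blockIncl e l),
      blockIncl_conjTranspose_mul_of_ne e hjl, Matrix.zero_mul, Matrix.mul_zero]
  refine ⟨hfam, (isBimodular_eta_iff hfam _).2 fun i j => ?_, fun j => ?_⟩
  · rw [← Matrix.mul_assoc, reindex_blockDiagonal'_mul_blockIncl, Matrix.mul_assoc,
      Matrix.mul_assoc, conjTranspose_blockIncl_mul_reindex_blockDiagonal']
  · exact (isCornerIndecomposable_eta_iff (hproj j) (blockIncl_conjTranspose_mul_self e j) rfl
      fun i => reindex_blockDiagonal'_mul_blockIncl e (fun j => B j i) j).2 (hunsplit j)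

theorem isLRSemisimple_of_isDCI {A : MatrixPencil d n} {c₁ c₂ : GL (Fin n) ℂ} {k : ℕ}
    {P : Fin k → Matrix (Fin n) (Fin n) ℂ}
    (h : MatrixMap.IsDCI P (MatrixMap.scaling (c₁ : Matrix (Fin n) (Fin n) ℂ)
      (c₂ : Matrix (Fin n) (Fin n) ℂ) A.eta)) : A.IsLRSemisimple := by
  rw [scaling_eta] at h
  obtain ⟨hfam, hbim, hcorner⟩ := h
  rw [isBimodular_eta_iff hfam] at hbim
  obtain ⟨hproj, horth, hsum⟩ := hfam
  obtain ⟨m, hPm⟩ : ∃ m : Fin k → ℕ, ∀ j, (P j).rank = m j := ⟨_, fun _ => rfl⟩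
  choose V W hWV hVW using fun j =>
    exists_factorization_of_isIdempotentElem (hproj j).isIdempotentElem (hPm j)
  have hm : ∑ j, m j = n := by
    have h1 : ∀ j, (m j : ℂ) = (P j).trace := fun j => by
      rw [← hVW j, trace_mul_comm, hWV, trace_one, Fintype.card_fin]
    have h2 : ((∑ j, m j : ℕ) : ℂ) = n := by
      push_cast
      simp only [h1]
      rw [← trace_sum, hsum, trace_one, Fintype.card_fin]
    exact_mod_cast h2
  have hPV : ∀ j, P j * V j = V j := fun j => by
    rw [← hVW j, Matrix.mul_assoc, hWV, Matrix.mul_one]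
  have hWP : ∀ j, W j * P j = W j := fun j => by
    rw [← hVW j, ← Matrix.mul_assoc, hWV, Matrix.one_mul]
  set A' : MatrixPencil d n := fun i =>
    (c₁ : Matrix (Fin n) (Fin n) ℂ) * A i * (c₂ : Matrix (Fin n) (Fin n) ℂ)ᴴ with hA'
  have hoff : ∀ i j l, j ≠ l → W j * A' i * V l = 0 := fun i j l hjl => by
    rw [← hPV l, ← hWP j, Matrix.mul_assoc (W j), ← hbim, ← Matrix.mul_assoc, ← Matrix.mul_assoc,
      Matrix.mul_assoc _ (P j), horth hjl, Matrix.mul_zero, Matrix.zero_mul]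
  set e : (Σ j, Fin (m j)) ≃ Fin n := finSigmaFinEquiv.trans (finCongr hm) with he
  -- the matrices with columns the `V j`, and with rows the `W j`
  let U : Matrix (Fin n) (Fin n) ℂ := Matrix.of fun a b => V (e.symm b).1 a (e.symm b).2
  let U' : Matrix (Fin n) (Fin n) ℂ := Matrix.of fun b a => W (e.symm b).1 (e.symm b).2 a
  have hU : ∀ a j y, U a (e ⟨j, y⟩) = V j a y := fun a j y => by
    change V (e.symm (e ⟨j, y⟩)).1 a (e.symm (e ⟨j, y⟩)).2 = _
    rw [e.symm_apply_apply]
  have hU' : ∀ a j y, U' (e ⟨j, y⟩) a = W j y a := fun a j y => by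
    change W (e.symm (e ⟨j, y⟩)).1 (e.symm (e ⟨j, y⟩)).2 a = _
    rw [e.symm_apply_apply]
  have hUU' : U * U' = 1 := by
    rw [← hsum]
    ext a b
    rw [Matrix.mul_apply, ← e.sum_comp, Fintype.sum_sigma, Matrix.sum_apply]
    refine Finset.sum_congr rfl fun j _ => ?_
    rw [← hVW j, Matrix.mul_apply]
    simp only [hU, hU']
  have hblock : ∀ i, U' * A' i * U =
      Matrix.reindex e e (Matrix.blockDiagonal' fun j => W j * A' i * V j) := fun i => by
    ext a b
    obtain ⟨⟨j, x⟩, rfl⟩ := e.surjective a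
    obtain ⟨⟨l, y⟩, rfl⟩ := e.surjective b
    have h1 : (U' * A' i * U) (e ⟨j, x⟩) (e ⟨l, y⟩) = (W j * A' i * V l) x y := by
      simp only [Matrix.mul_apply, hU, hU']
    rw [h1, reindex_apply, submatrix_apply, e.symm_apply_apply, e.symm_apply_apply]
    by_cases hjl : j = l
    · subst hjl
      rw [blockDiagonal'_apply_eq]
    · rw [blockDiagonal'_apply_ne _ _ _ hjl, hoff i j l hjl, Matrix.zero_apply]
  let u : GL (Fin n) ℂ := ⟨U, U', hUU', mul_eq_one_comm.1 hUU'⟩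
  refine ⟨u⁻¹ * c₁, star c₂ * u, k, m, hm, fun j i => W j * A' i * V j,
    fun i => ?_, fun j => ?_⟩
  · rw [← he, ← hblock]
    simp [u, hA', Matrix.mul_assoc, star_eq_conjTranspose]
  · refine (isCornerIndecomposable_eta_iff (A := A') (hproj j) (hWV j) (hVW j) fun i => ?_).1
      (hcorner j)
    have := hbim i j
    rw [← Matrix.mul_assoc, ← Matrix.mul_assoc, hVW, ← this, Matrix.mul_assoc _ (P j), hPV]

end MatrixPencil

theorem mainTheorem10 (d n : ℕ) (A : MatrixPencil d n) :
    ((A.IsFull ↔ MatrixMap.IsRankNonDecreasing A.eta) ∧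
      (MatrixMap.IsRankNonDecreasing A.eta ↔ 0 < MatrixMap.capacity A.eta)) ∧
    (A.IsUnsplittable ↔ MatrixMap.IsIndecomposable A.eta) ∧
    (A.IsLRSemisimple ↔
      ∃ (c₁ c₂ : GL (Fin n) ℂ) (k : ℕ) (P : Fin k → Matrix (Fin n) (Fin n) ℂ),
        MatrixMap.IsDCI P (MatrixMap.scaling (c₁ : Matrix (Fin n) (Fin n) ℂ)
          (c₂ : Matrix (Fin n) (Fin n) ℂ) A.eta)) :=
  ⟨⟨A.isFull_iff_isRankNonDecreasing, A.isRankNonDecreasing_iff_capacity_pos⟩,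
    A.isUnsplittable_iff_isIndecomposable,
    MatrixPencil.exists_isDCI_of_isLRSemisimple,
    fun ⟨_, _, _, _, h⟩ => MatrixPencil.isLRSemisimple_of_isDCI h⟩
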